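/- Let $d\ge 1$. Operations on vectors are componentwise, and $1/\infty=0$. A probability law $G$ on $\mathbb R^d$ is \emph{simple max-stable} if it has unit Fréchet margins, $G(\{y: y_i\le x\})=e^{-1/x}$ for $x>0$ and all $i$, and if for each $n\ge 1$ there are $a_n\in(0,\infty)^d$, $b_n\in\mathbb R^d$ such that the componentwise maximum of $n$ independent random vectors with law $G$ has the law of $a_nX+b_n$, where $X\sim G$. Write $G(x)=\mathbb P(X\le x)=\exp(-V(x))$ for $x\in(0,\infty]^d$. - An \emph{exponent measure} of $G$ is a Borel measure $\Lambda$ on $\mathbb R^d$, concentrated on $[0,\infty)^d\setminus\{0\}$, with $\Lambda(tB)=t^{-1}\Lambda(B)$ for $t>0$ and Borel $B$, $\Lambda(\{y:y_i>1\})=1$ for all $i$, and $V(x)=\Lambda(\{y: y_i>x_i\text{ for some }i\})$ for $x\in(0,\infty]^d$. - A \emph{generator} of $G$ is a random vector $Z$ with $Z\ge 0$ almost surely, $\mathbb E Z_i=1$ for all $i$, and $V(x)=\mathbb E\max_i (Z_i/x_i)$ for $x\in(0,\infty]^d$. - A \emph{stable tail dependence function} of $G$ is a function $\ell:[0,\infty)^d\to[0,\infty)$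 with $\ell(tx)=t\ell(x)$ for $t\ge0$, $\ell(e_i)=1$ for all $i$ ($e_i$ being the standard unit vectors), $\sum_{I\subset\{1,\dots,n\}}(-1)^{|I|}\,\ell\big(s\vee\bigvee_{i\in I}s_i\big)\le 0$ for all $n\ge1$ and $s,s_1,\dots,s_n\in[0,\infty)^d$ ($\vee$ being the componentwise maximum), and $V(x)=\ell(1/x_1,\dots,1/x_d)$ for $x\in(0,\infty]^d$. - The \emph{max-zonoid} is $K=\{k\in[0,\infty)^d:\langle k,x\rangle\le\ell(x)\text{ for all }x\in[0,\infty)^d\}$. For $a\in\mathbb R^d$ let $U_a=\{x: x_i>a_i\ \forall i\}$ and $L_a=\{x:x_i\le a_i\ \forall i\}$. For laws: $G\le_{\mathrm{uo}}\widetilde G$ if $G(U_a)\le\widetilde G(U_a)$ for all $a\in\mathbb R^d$; $G\le_{\mathrm{lo}}\widetilde G$ if $G(L_a)\ge\widetilde G(L_a)$ for all $a\in\mathbb R^d$; $G\le_{\mathrm{PQD}}\widetilde G$ if $G\le_{\mathrm{uo}}\widetilde G$ and $\widetilde G\le_{\mathrm{lo}}G$. A set is \emph{bounded away from the origin} if it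 is disjoint from $L_{(\varepsilon,\dots,\varepsilon)}$ for some $\varepsilon>0$. For exponent measures: $\Lambda\le_{\mathrm{uo}}\widetilde\Lambda$ if $\Lambda(U_a)\le\widetilde\Lambda(U_a)$ for all $a\in\mathbb R^d$ such that $U_a$ is bounded away from the origin; $\Lambda\le_{\mathrm{lo}}\widetilde\Lambda$ if $\Lambda(\mathbb R^d\setminus L_a)\le\widetilde\Lambda(\mathbb R^d\setminus L_a)$ for all $a\in\mathbb R^d$ such that $\mathbb R^d\setminus L_a$ is bounded away from the origin. **Theorem.** Let $G$ and $\widetilde G$ be $d$-variate simple max-stable laws with exponent measures $\Lambda,\widetilde\Lambda$, generators $Z,\widetilde Z$ (possibly defined on different probability spaces), stable tail dependence functions $\ell,\widetilde\ell$ and max-zonoids $K,\widetilde K$, respectively. (a) The following are equivalent: (i) $G\le_{\mathrm{lo}}\widetilde G$; (ii) $\Lambda\le_{\mathrm{lo}}\widetilde\Lambda$; (iii) $\mathbb E\max_{i=1,\dots,d}(a_iZ_i)\le\mathbb E\max_{i=1,\dots,d}(a_i\widetilde Z_i)$ for all $a\in(0,\infty)^d$; (iv) $\ell(x)\le\widetilde\ell(x)$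 for all $x\in[0,\infty)^d$; (v) $K\subset\widetilde K$. (b) The following are equivalent: (i) $G\le_{\mathrm{uo}}\widetilde G$; (ii) $\Lambda\le_{\mathrm{uo}}\widetilde\Lambda$; (iii) $\mathbb E\min_{i\in A}(a_iZ_i)\le\mathbb E\min_{i\in A}(a_i\widetilde Z_i)$ for all $a\in(0,\infty)^d$ and all nonempty $A\subset\{1,\dots,d\}$. (c) If $d=2$, the following are equivalent: (i) $G\le_{\mathrm{PQD}}\widetilde G$; (ii) $G\le_{\mathrm{uo}}\widetilde G$; (iii) $\widetilde G\le_{\mathrm{lo}}G$. -/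

import Mathlib

open MeasureTheory
open scoped NNReal ENNReal Pointwise

namespace MaxStable

/-! ### Simple max-stable laws on `ℝ^d` and their dependence descriptors -/

section Laws

variable {d : ℕ}

/-- A law `G` on `ℝ^d` is max-stable if for each number `n + 1 ≥ 1` of i.i.d. copies
`X₀, …, Xₙ ∼ G` there are `a > 0` and `b` such that the componentwise maximum of the copies
has the same law as `a X + b`, `X ∼ G`. -/
def IsMaxStable (G : Measure (Fin d → ℝ)) : Prop :=
  ∀ n : ℕ, ∃ a b : Fin d → ℝ, (∀ i, 0 < a i) ∧
    Measure.map
        (fun (x : Fin (n + 1) → Fin d → ℝ) (i : Fin d) =>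
          Finset.univ.sup' Finset.univ_nonempty (fun k => x k i))
        (Measure.pi (fun _ : Fin (n + 1) => G))
      = Measure.map (fun (x : Fin d → ℝ) (i : Fin d) => a i * x i + b i) G

/-- A simple max-stable law: a max-stable probability law with standard unit Fréchet margins. -/
structure IsSimpleMaxStable (G : Measure (Fin d → ℝ)) : Prop where
  isProbabilityMeasure : IsProbabilityMeasure G
  isMaxStable : IsMaxStable G
  frechet_margins : ∀ i : Fin d, ∀ x : ℝ, 0 < x →
    G.real {y | y i ≤ x} = Real.exp (-(1 / x))

/-- The distribution function `G(x) = P(X ≤ x)` at points `x ∈ (0, ∞]^d`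
(for `x i > 0`, the condition `ENNReal.ofReal (y i) ≤ x i` says exactly `y i ≤ x i`). -/
noncomputable def distFun (G : Measure (Fin d → ℝ)) (x : Fin d → ℝ≥0∞) : ℝ :=
  G.real {y | ∀ i, ENNReal.ofReal (y i) ≤ x i}

/-- `Λ` is the exponent measure of `G`: it is concentrated on `[0, ∞)^d \ {0}`, homogeneous of
order `-1`, normalised, and `G(x) = exp (-V(x))` with `V(x) = Λ {y | y i > x i for some i}` for
`x ∈ (0, ∞]^d`. (Homogeneity and normalisation make all these values of `Λ` finite.) -/
structure IsExponentMeasure (G Λ : Measure (Fin d → ℝ)) : Prop where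
  concentrated : Λ {y | (∀ i, 0 ≤ y i) ∧ y ≠ 0}ᶜ = 0
  homogeneous : ∀ t : ℝ, 0 < t → ∀ B : Set (Fin d → ℝ), MeasurableSet B →
    Λ (t • B) = ENNReal.ofReal t⁻¹ * Λ B
  normalised : ∀ i : Fin d, Λ {y | 1 < y i} = 1
  distFun_eq : ∀ x : Fin d → ℝ≥0∞, (∀ i, 0 < x i) →
    distFun G x = Real.exp (-(Λ.real {y | ∃ i, x i < ENNReal.ofReal (y i)}))

/-- The random vector `Z`, defined on a probability space `(Ω, P)`, is a generator of `G`: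
`Z ≥ 0`, `E Z i = 1`, and `G(x) = exp (-V(x))` with `V(x) = E max_i (Z i / x i)` for
`x ∈ (0, ∞]^d`, where `Z i / ∞ = 0`. -/
structure IsGenerator [NeZero d] {Ω : Type*} [MeasurableSpace Ω] (G : Measure (Fin d → ℝ))
    (P : Measure Ω) (Z : Ω → Fin d → ℝ) : Prop where
  measurable : Measurable Z
  nonneg : ∀ᵐ ω ∂P, ∀ i, 0 ≤ Z ω i
  integrable : ∀ i, Integrable (fun ω => Z ω i) P
  integral_eq_one : ∀ i, ∫ ω, Z ω i ∂P = 1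
  distFun_eq : ∀ x : Fin d → ℝ≥0∞, (∀ i, 0 < x i) →
    distFun G x = Real.exp (-(∫ ω, Finset.univ.sup' Finset.univ_nonempty
      (fun i => Z ω i * ((x i)⁻¹).toReal) ∂P))

/-- Complete alternation of `ℓ : [0, ∞)^d → [0, ∞)` with respect to the semigroup operation
"componentwise maximum": all iterated differences `(Δ_{s₁} ⋯ Δ_{sₙ} ℓ) (s)`, `n ≥ 1`, are `≤ 0`. -/
def IsMaxCompletelyAlternating (ℓ : (Fin d → ℝ≥0) → ℝ≥0) : Prop :=
  ∀ n : ℕ, 1 ≤ n → ∀ (s : Fin n → Fin d → ℝ≥0) (s₀ : Fin d → ℝ≥0),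
    ∑ I : Finset (Fin n), (-1 : ℝ) ^ I.card * (ℓ (s₀ ⊔ I.sup s) : ℝ) ≤ 0

/-- `ℓ : [0, ∞)^d → [0, ∞)` is the stable tail dependence function of `G`: it is homogeneous of
order `1`, max-completely alternating, normalised, and `G(x) = exp (-V(x))` with
`V(x) = ℓ (1 / x₁, …, 1 / x_d)` for `x ∈ (0, ∞]^d`, where `1 / ∞ = 0`. -/
structure IsStableTailDependenceFunction (G : Measure (Fin d → ℝ))
    (ℓ : (Fin d → ℝ≥0) → ℝ≥0) : Prop where
  homogeneous : ∀ (t : ℝ≥0) (x : Fin d → ℝ≥0), ℓ (t • x) = t * ℓ x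
  alternating : IsMaxCompletelyAlternating ℓ
  normalised : ∀ i : Fin d, ℓ (Pi.single i 1) = 1
  distFun_eq : ∀ x : Fin d → ℝ≥0∞, (∀ i, 0 < x i) →
    distFun G x = Real.exp (-(ℓ (fun i => ((x i)⁻¹).toNNReal) : ℝ))

/-- The max-zonoid (dependency set) belonging to a stable tail dependence function `ℓ`:
`K = {k ∈ [0, ∞)^d | ⟨k, x⟩ ≤ ℓ(x) for all x ∈ [0, ∞)^d}`. -/
def maxZonoid (ℓ : (Fin d → ℝ≥0) → ℝ≥0) : Set (Fin d → ℝ) :=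
  {k | (∀ i, 0 ≤ k i) ∧ ∀ x : Fin d → ℝ≥0, ∑ i, k i * (x i : ℝ) ≤ (ℓ x : ℝ)}

end Laws

/-! ### Orthant orders -/

section Orders

variable {d : ℕ}

/-- The upper orthant `U_a = {x | x i > a i for all i}`. -/
def upperOrthant (a : Fin d → ℝ) : Set (Fin d → ℝ) := {x | ∀ i, a i < x i}

/-- The lower orthant `L_a = {x | x i ≤ a i for all i}`. -/
def lowerOrthant (a : Fin d → ℝ) : Set (Fin d → ℝ) := {x | ∀ i, x i ≤ a i}

/-- Upper orthant order of probability laws. -/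
def UOLE (G G' : Measure (Fin d → ℝ)) : Prop :=
  ∀ a : Fin d → ℝ, G (upperOrthant a) ≤ G' (upperOrthant a)

/-- Lower orthant order of probability laws; note the reversed inequality. -/
def LOLE (G G' : Measure (Fin d → ℝ)) : Prop :=
  ∀ a : Fin d → ℝ, G' (lowerOrthant a) ≤ G (lowerOrthant a)

/-- Positive quadrant dependence (concordance) order of probability laws. -/
def PQDLE (G G' : Measure (Fin d → ℝ)) : Prop := UOLE G G' ∧ LOLE G' G

/-- `B ⊆ ℝ^d` is bounded away from the origin: it misses the lower orthant of
`(ε, …, ε)` for some `ε > 0`. -/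
def BoundedAwayFromOrigin (B : Set (Fin d → ℝ)) : Prop :=
  ∃ ε : ℝ, 0 < ε ∧ B ∩ lowerOrthant (fun _ => ε) = ∅

/-- Upper orthant order of exponent measures. -/
def ExponentUOLE (Λ Λ' : Measure (Fin d → ℝ)) : Prop :=
  ∀ a : Fin d → ℝ, BoundedAwayFromOrigin (upperOrthant a) →
    Λ (upperOrthant a) ≤ Λ' (upperOrthant a)

/-- Lower orthant order of exponent measures. -/
def ExponentLOLE (Λ Λ' : Measure (Fin d → ℝ)) : Prop :=
  ∀ a : Fin d → ℝ, BoundedAwayFromOrigin (lowerOrthant a)ᶜ →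
    Λ (lowerOrthant a)ᶜ ≤ Λ' (lowerOrthant a)ᶜ

end Orders

end MaxStable

open MaxStable

/-! All descriptors encode one function. For `u ∈ [0, ∞)^d`, `ℓ u` is the `Λ`-mass of `⋃ i, {u i * y
i > 1}`, the mean of `max_i (u i * Z i)`, and minus the logarithm of the `G`-mass of the
complementary lower orthant.

For (a), the first three conditions therefore compare `ℓ` and `ℓ'` at points with positive
coordinates. Monotonicity and a diagonal subadditivity bound carry this to the boundary. The
max-zonoid determines `ℓ` because its support function equals `ℓ`, the supremum being attained.

For (b), inclusion-exclusion over subsets of a nonempty `A` turns unions into intersections. Both `Λ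
(⋂ i ∈ A, {u i * y i > 1})` and the mean of `min_{i ∈ A} (u i * Z i)` equal the same alternating sum
of `ℓ (cutoff B u)`, while joint survival probabilities are alternating sums of `exp (-ℓ (cutoff B
u))`. Replacing `u` by `s • u` and differentiating at `s = 0` passes from laws to exponent measures.
Conversely, interpolate between `exp (-ℓ)` and `exp (-ℓ')` geometrically: the derivative of the
survival sum is a sum of terms `m' C - m C`, the differences of intersection masses, weighted by
probabilities for `max ((1 - t) X) (t X')` with independent `X ∼ G`, `X' ∼ G'`. Hence it is
nonnegative (`sum_neg_one_pow_mul_exp_neg_mono`, `sum_neg_one_pow_mul_exp_interpolation_nonneg`).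

For (c), in the plane the survival and distribution functions differ only by marginal terms, and the
margins agree. -/

namespace MaxStable

/-! ### Inclusion-exclusion and the maximum-minimums identity -/

section InclusionExclusion

variable {ι α : Type*} [MeasurableSpace α]

/-- Inclusion-exclusion for the measure of an intersection of complements. -/
theorem measureReal_biInter_compl (μ : Measure α) [IsFiniteMeasure μ] (A : Finset ι)
    {E : ι → Set α} (hE : ∀ i, MeasurableSet (E i)) :
    μ.real (⋂ i ∈ A, (E i)ᶜ) = ∑ B ∈ A.powerset, (-1 : ℝ) ^ B.card * μ.real (⋂ i ∈ B, E i) := by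
  classical
  have h1 : (⋂ i ∈ A, (E i)ᶜ) = (⋃ i ∈ A, E i)ᶜ := by simp
  rw [h1, measureReal_compl (Finset.measurableSet_biUnion _ fun i _ => hE i),
    measureReal_biUnion_eq_sum_powerset (fun i _ => hE i) (fun i _ => measure_ne_top _ _),
    ← Finset.sum_filter_add_sum_filter_not A.powerset (·.Nonempty)]
  have h2 : A.powerset.filter (fun B => ¬ B.Nonempty) = {∅} := by
    ext B; simp only [Finset.mem_filter, Finset.mem_powerset, Finset.not_nonempty_iff_eq_empty,
      Finset.mem_singleton]
    exact ⟨fun h => h.2, fun h => ⟨by simp [h], h⟩⟩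
  rw [h2, Finset.sum_singleton]
  simp only [Finset.card_empty, pow_zero, one_mul, Finset.notMem_empty, Set.iInter_of_empty,
    Set.iInter_univ, pow_succ, mul_neg, mul_one, neg_mul, Finset.sum_neg_distrib]
  ring

/-- Restricting to `S` gives a finite measure, so the finite formula also serves measures of
infinite total mass, such as exponent measures. -/
theorem measureReal_inter_biInter_compl (μ : Measure α) {S : Set α}
    (hS' : μ S ≠ ∞) (A : Finset ι) {E : ι → Set α} (hE : ∀ i, MeasurableSet (E i)) :
    μ.real ((⋂ i ∈ A, (E i)ᶜ) ∩ S) =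
      ∑ B ∈ A.powerset, (-1 : ℝ) ^ B.card * μ.real ((⋂ i ∈ B, E i) ∩ S) := by
  have : IsFiniteMeasure (μ.restrict S) := ⟨by simpa using hS'.lt_top⟩
  have h := measureReal_biInter_compl (μ.restrict S) A hE
  rw [measureReal_restrict_apply (Finset.measurableSet_biInter _ fun i _ => (hE i).compl)] at h
  rw [h]
  refine Finset.sum_congr rfl fun B _ => ?_
  rw [measureReal_restrict_apply (Finset.measurableSet_biInter _ fun i _ => hE i)]

theorem sum_powerset_neg_one_pow_card_eq_zero {A : Finset ι} (hA : A.Nonempty) :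
    ∑ B ∈ A.powerset, (-1 : ℝ) ^ B.card = 0 := by
  have := Finset.sum_powerset_neg_one_pow_card_of_nonempty hA
  exact_mod_cast this

/-- The measure of an intersection as the alternating sum of the measures of the unions. -/
theorem measureReal_biInter_eq_sum_biUnion (μ : Measure α) {A : Finset ι} (hA : A.Nonempty)
    {E : ι → Set α} (hE : ∀ i, MeasurableSet (E i)) (hfin : ∀ i ∈ A, μ (E i) ≠ ∞) :
    μ.real (⋂ i ∈ A, E i) =
      ∑ B ∈ A.powerset, (-1 : ℝ) ^ (B.card + 1) * μ.real (⋃ i ∈ B, E i) := by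
  have hU : MeasurableSet (⋃ i ∈ A, E i) := Finset.measurableSet_biUnion _ fun i _ => hE i
  have hUf : μ (⋃ i ∈ A, E i) ≠ ∞ :=
    ((measure_biUnion_lt_top A.finite_toSet fun i hi => (hfin i hi).lt_top)).ne
  -- The computation takes place inside the union, which has finite mass and contains the
  -- intersection because `A` is nonempty. The constant terms then cancel, since the signs over all
  -- subsets sum to zero.
  have h := measureReal_inter_biInter_compl μ hUf A (fun i => (hE i).compl)
  simp only [compl_compl] at h
  have h1 : (⋂ i ∈ A, E i) ∩ (⋃ i ∈ A, E i) = ⋂ i ∈ A, E i := by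
    refine Set.inter_eq_left.2 fun x hx => ?_
    obtain ⟨i, hi⟩ := hA
    exact Set.mem_biUnion hi (Set.mem_iInter₂.1 hx i hi)
  rw [h1] at h
  have h2 : ∀ B ∈ A.powerset, μ.real ((⋂ i ∈ B, (E i)ᶜ) ∩ (⋃ i ∈ A, E i)) =
      μ.real (⋃ i ∈ A, E i) - μ.real (⋃ i ∈ B, E i) := by
    intro B hB
    have hsub : (⋃ i ∈ B, E i) ⊆ ⋃ i ∈ A, E i :=
      Set.biUnion_subset_biUnion_left (Finset.mem_powerset.1 hB)
    rw [← measureReal_sdiff hsub (Finset.measurableSet_biUnion _ fun i _ => hE i)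
      hUf]
    congr 1
    ext x; simp [and_comm]
  rw [h, Finset.sum_congr rfl fun B hB => by rw [h2 B hB, mul_sub], Finset.sum_sub_distrib,
    ← Finset.sum_mul, sum_powerset_neg_one_pow_card_eq_zero hA, zero_mul, zero_sub,
    ← Finset.sum_neg_distrib]
  exact Finset.sum_congr rfl fun B _ => by ring

/-- The maximum-minimums identity. -/
theorem inf'_eq_sum_sup' [Fintype ι] [Nonempty ι] [DecidableEq ι] {A : Finset ι}
    (hA : A.Nonempty) {t : ι → ℝ} (ht : ∀ i, 0 ≤ t i) :
    A.inf' hA t = ∑ B ∈ A.powerset, (-1 : ℝ) ^ (B.card + 1) *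
      Finset.univ.sup' Finset.univ_nonempty (fun i => if i ∈ B then t i else 0) := by
  -- Lengths of the intervals `[0, t i)` turn minima into intersections and maxima into unions.
  have h := measureReal_biInter_eq_sum_biUnion (volume : Measure ℝ) hA
    (E := fun i => Set.Ico 0 (t i)) (fun i => measurableSet_Ico) (fun i _ => by simp)
  have h1 : (⋂ i ∈ A, Set.Ico 0 (t i)) = Set.Ico 0 (A.inf' hA t) := by
    ext x
    have hA' := hA
    obtain ⟨j, hj⟩ := hA'
    simp only [Set.mem_iInter, Set.mem_Ico, Finset.lt_inf'_iff]
    exact ⟨fun h => ⟨(h j hj).1, fun i hi => (h i hi).2⟩, fun h i hi => ⟨h.1, h.2 i hi⟩⟩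
  have h2 : ∀ B : Finset ι, (⋃ i ∈ B, Set.Ico 0 (t i)) = Set.Ico 0
      (Finset.univ.sup' Finset.univ_nonempty (fun i => if i ∈ B then t i else 0)) := by
    intro B
    ext x
    simp only [Set.mem_iUnion, Set.mem_Ico, Finset.lt_sup'_iff, Finset.mem_univ, true_and]
    constructor
    · rintro ⟨i, hi, h0, hx⟩
      exact ⟨h0, i, by simpa [hi] using hx⟩
    · rintro ⟨h0, i, hx⟩
      split_ifs at hx with hi
      · exact ⟨i, hi, h0, hx⟩
      · exact absurd hx (not_lt.2 h0)
  have h3 : ∀ B : Finset ι, 0 ≤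
      Finset.univ.sup' Finset.univ_nonempty (fun i => if i ∈ B then t i else 0) := by
    intro B
    obtain ⟨j⟩ := ‹Nonempty ι›
    refine le_trans ?_ (Finset.le_sup' _ (Finset.mem_univ j))
    split_ifs
    exacts [ht j, le_rfl]
  have h4 : 0 ≤ A.inf' hA t := Finset.le_inf' _ _ fun i _ => ht i
  simpa [h1, h2, h3, h4, Real.volume_real_Ico_of_le] using h

end InclusionExclusion

/-! ### Comparing alternating sums of exponentials -/

section Monotonicity

variable {ι : Type*} [DecidableEq ι]

/-- Each `B ⊇ C` is uniquely `C ∪ D` with `D ⊆ A \ C`, so the sums may be exchanged to collect the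
coefficient of each `C`. -/
theorem sum_powerset_sum_powerset_comm (A : Finset ι) (f : Finset ι → Finset ι → ℝ) :
    ∑ B ∈ A.powerset, ∑ C ∈ B.powerset with C.Nonempty, f B C =
      ∑ C ∈ A.powerset with C.Nonempty, ∑ D ∈ (A \ C).powerset, f (C ∪ D) C := by
  have h : ∀ C ∈ A.powerset.filter (·.Nonempty),
      ∑ D ∈ (A \ C).powerset, f (C ∪ D) C = ∑ B ∈ A.powerset with C ⊆ B, f B C := by
    intro C hC
    simp only [Finset.mem_filter, Finset.mem_powerset] at hC
    refine Finset.sum_nbij' (fun D => C ∪ D) (fun B => B \ C) ?_ ?_ ?_ ?_ ?_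
    · intro D hD
      simp only [Finset.mem_filter, Finset.mem_powerset] at hD ⊢
      exact ⟨Finset.union_subset hC.1 (hD.trans Finset.sdiff_subset), Finset.subset_union_left⟩
    · intro B hB
      simp only [Finset.mem_filter, Finset.mem_powerset] at hB ⊢
      exact Finset.sdiff_subset_sdiff hB.1 le_rfl
    · intro D hD
      simp only [Finset.mem_powerset] at hD
      grind
    · intro B hB
      simp only [Finset.mem_filter, Finset.mem_powerset] at hB
      exact Finset.union_sdiff_of_subset hB.2
    · intros; rfl
  rw [Finset.sum_congr rfl h]
  refine Finset.sum_comm' fun B C => ?_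
  simp only [Finset.mem_filter, Finset.mem_powerset]
  constructor
  · rintro ⟨h1, h2, h3⟩; exact ⟨⟨h1, h2⟩, h2.trans h1, h3⟩
  · rintro ⟨⟨h1, h2⟩, h3, h4⟩; exact ⟨h1, h2, h4⟩

/-- If `V`, `V'` are the union functions belonging to the intersection functions `m ≤ m'` and all
the geometric interpolations of `exp (-V)` and `exp (-V')` are distribution functions, then the
alternating sums of `exp (-V)` and `exp (-V')` (the survival probabilities) are ordered. -/
theorem sum_neg_one_pow_mul_exp_neg_mono (A : Finset ι) {V V' m m' : Finset ι → ℝ}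
    (hV : ∀ B ⊆ A, V B = ∑ C ∈ B.powerset with C.Nonempty, (-1 : ℝ) ^ (C.card + 1) * m C)
    (hV' : ∀ B ⊆ A, V' B = ∑ C ∈ B.powerset with C.Nonempty, (-1 : ℝ) ^ (C.card + 1) * m' C)
    (hm : ∀ C ⊆ A, C.Nonempty → m C ≤ m' C)
    (hpos : ∀ t : ℝ, 0 < t → t < 1 → ∀ C ⊆ A, 0 ≤ ∑ D ∈ (A \ C).powerset,
      (-1 : ℝ) ^ D.card * Real.exp (-((1 - t) * V (C ∪ D) + t * V' (C ∪ D)))) :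
    ∑ B ∈ A.powerset, (-1 : ℝ) ^ B.card * Real.exp (-V B) ≤
      ∑ B ∈ A.powerset, (-1 : ℝ) ^ B.card * Real.exp (-V' B) := by
  -- `F` joins the two sides of the claim, at `t = 0` and `t = 1`, so a nonnegative derivative on
  -- the open interval suffices.
  set F : ℝ → ℝ := fun t => ∑ B ∈ A.powerset,
    (-1 : ℝ) ^ B.card * Real.exp (-((1 - t) * V B + t * V' B)) with hF
  have hd : ∀ t, HasDerivAt F (∑ B ∈ A.powerset, (-1 : ℝ) ^ B.card *
      (Real.exp (-((1 - t) * V B + t * V' B)) * (V B - V' B))) t := by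
    intro t
    refine HasDerivAt.fun_sum fun B _ => HasDerivAt.const_mul _ (HasDerivAt.exp ?_)
    have h := ((((hasDerivAt_id t).const_sub 1).mul_const (V B)).add
      ((hasDerivAt_id t).mul_const (V' B))).neg
    convert! h using 1
    ring
  have hmono : MonotoneOn F (Set.Icc 0 1) := by
    refine monotoneOn_of_deriv_nonneg (convex_Icc 0 1)
      (fun t _ => (hd t).continuousAt.continuousWithinAt)
      (fun t _ => (hd t).differentiableAt.differentiableWithinAt) ?_
    intro t ht
    rw [interior_Icc] at ht
    rw [(hd t).deriv]
    have h1 : ∑ B ∈ A.powerset, (-1 : ℝ) ^ B.card *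
        (Real.exp (-((1 - t) * V B + t * V' B)) * (V B - V' B)) =
        ∑ B ∈ A.powerset, ∑ C ∈ B.powerset with C.Nonempty, (-1 : ℝ) ^ (B.card + C.card) *
          (Real.exp (-((1 - t) * V B + t * V' B)) * (m' C - m C)) := by
      refine Finset.sum_congr rfl fun B hB => ?_
      rw [Finset.mem_powerset] at hB
      rw [show V B - V' B = ∑ C ∈ B.powerset with C.Nonempty,
        (-1 : ℝ) ^ C.card * (m' C - m C) by
          rw [hV B hB, hV' B hB, ← Finset.sum_sub_distrib]
          exact Finset.sum_congr rfl fun C _ => by ring]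
      rw [Finset.mul_sum, Finset.mul_sum]
      exact Finset.sum_congr rfl fun C _ => by ring
    rw [h1, sum_powerset_sum_powerset_comm A (fun B C => (-1 : ℝ) ^ (B.card + C.card) *
          (Real.exp (-((1 - t) * V B + t * V' B)) * (m' C - m C)))]
    refine Finset.sum_nonneg fun C hC => ?_
    simp only [Finset.mem_filter, Finset.mem_powerset] at hC
    -- As `C` and `D` are disjoint, `|C|` is counted twice in the exponent and only the sign of `D`
    -- survives. The remaining sum is the one in `hpos`.
    have h2 : ∑ D ∈ (A \ C).powerset, (-1 : ℝ) ^ ((C ∪ D).card + C.card) *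
        (Real.exp (-((1 - t) * V (C ∪ D) + t * V' (C ∪ D))) * (m' C - m C)) =
        (m' C - m C) * ∑ D ∈ (A \ C).powerset, (-1 : ℝ) ^ D.card *
          Real.exp (-((1 - t) * V (C ∪ D) + t * V' (C ∪ D))) := by
      rw [Finset.mul_sum]
      refine Finset.sum_congr rfl fun D hD => ?_
      rw [Finset.mem_powerset] at hD
      rw [Finset.card_union_of_disjoint
        (Finset.disjoint_of_subset_right hD Finset.disjoint_sdiff),
        show C.card + D.card + C.card = 2 * C.card + D.card by ring, pow_add, pow_mul]
      simp only [even_two, Even.neg_pow, one_pow, one_mul]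
      ring
    rw [h2]
    exact mul_nonneg (sub_nonneg.2 (hm C hC.1 hC.2)) (hpos t ht.1 ht.2 C hC.1)
  have := hmono (Set.left_mem_Icc.2 zero_le_one) (Set.right_mem_Icc.2 zero_le_one) zero_le_one
  simpa [hF] using this

end Monotonicity

/-- Converse comparison, by differentiating the survival probabilities at `0`. -/
theorem sum_neg_one_pow_mul_le_of_exp_neg {ι : Type*} {A : Finset ι} (hA : A.Nonempty) {V V' : Finset ι → ℝ}
    (h : ∀ s : ℝ, 0 < s → ∑ B ∈ A.powerset, (-1 : ℝ) ^ B.card * Real.exp (-(s * V B)) ≤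
      ∑ B ∈ A.powerset, (-1 : ℝ) ^ B.card * Real.exp (-(s * V' B))) :
    ∑ B ∈ A.powerset, (-1 : ℝ) ^ (B.card + 1) * V B ≤
      ∑ B ∈ A.powerset, (-1 : ℝ) ^ (B.card + 1) * V' B := by
  have hd : ∀ W : Finset ι → ℝ, Filter.Tendsto
      (fun s : ℝ => s⁻¹ * ∑ B ∈ A.powerset, (-1 : ℝ) ^ B.card * Real.exp (-(s * W B)))
      (nhdsWithin 0 (Set.Ioi 0)) (nhds (∑ B ∈ A.powerset, (-1 : ℝ) ^ (B.card + 1) * W B)) := by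
    intro W
    have h1 : HasDerivAt (fun s : ℝ => ∑ B ∈ A.powerset,
        (-1 : ℝ) ^ B.card * Real.exp (-(s * W B)))
        (∑ B ∈ A.powerset, (-1 : ℝ) ^ (B.card + 1) * W B) 0 := by
      have : ∀ B ∈ A.powerset, HasDerivAt (fun s : ℝ => (-1 : ℝ) ^ B.card * Real.exp (-(s * W B)))
          ((-1 : ℝ) ^ (B.card + 1) * W B) 0 := by
        intro B _
        have h2 := (((hasDerivAt_id (0 : ℝ)).mul_const (W B)).neg.exp).const_mul
          ((-1 : ℝ) ^ B.card)
        convert! h2 using 1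
        simp [pow_succ]
      exact HasDerivAt.fun_sum this
    -- The sum vanishes at `s = 0` because `A` is nonempty, so the difference quotient is just `s⁻¹`
    -- times the sum.
    have h3 := h1.tendsto_slope_zero_right
    simpa [sum_powerset_neg_one_pow_card_eq_zero hA] using h3
  refine le_of_tendsto_of_tendsto (hd V) (hd V') ?_
  filter_upwards [self_mem_nhdsWithin] with s hs
  exact mul_le_mul_of_nonneg_left (h s hs) (inv_nonneg.2 (le_of_lt hs))

/-- The vector `u` with the coordinates outside `B` replaced by `0`. -/
def cutoff {d : ℕ} (B : Finset (Fin d)) (u : Fin d → ℝ≥0) : Fin d → ℝ≥0 :=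
  fun i => if i ∈ B then u i else 0

/-- The half space `{y | 1 < c y_i}`. -/
def exceed {d : ℕ} (c : ℝ≥0) (i : Fin d) : Set (Fin d → ℝ) := {y | 1 < (c : ℝ) * y i}

/-! ### Half spaces and truncated vectors -/

section Basic

variable {d : ℕ}

theorem measurableSet_exceed (c : ℝ≥0) (i : Fin d) : MeasurableSet (exceed c i) :=
  measurableSet_lt measurable_const ((measurable_pi_apply i).const_mul _)

theorem exceed_zero (i : Fin d) : exceed 0 i = ∅ := by
  ext y
  simp [exceed, (zero_lt_one' ℝ).not_gt]

/-- The threshold `x i = ∞` corresponds to `c = 0`, where both sides hold trivially. Zero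
coordinates of `u` thus drop constraints, which is how lower-dimensional margins are reached. -/
theorem ofReal_le_inv_iff (c : ℝ≥0) (r : ℝ) :
    ENNReal.ofReal r ≤ (c : ℝ≥0∞)⁻¹ ↔ (c : ℝ) * r ≤ 1 := by
  rcases eq_or_ne c 0 with rfl | hc
  · simp
  · have hc' : (0 : ℝ) < c := by positivity
    rw [← ENNReal.coe_inv hc, ENNReal.ofReal, ENNReal.coe_le_coe, Real.toNNReal_le_iff_le_coe,
      NNReal.coe_inv, ← one_div, le_div_iff₀ hc', mul_comm]

theorem inv_coe_pos (u : Fin d → ℝ≥0) (i : Fin d) : 0 < ((u i : ℝ≥0∞))⁻¹ :=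
  ENNReal.inv_pos.2 ENNReal.coe_ne_top

theorem iUnion_exceed_cutoff (B : Finset (Fin d)) (u : Fin d → ℝ≥0) :
    (⋃ i, exceed (cutoff B u i) i) = ⋃ i ∈ B, exceed (u i) i := by
  refine Set.iUnion_congr fun i => ?_
  by_cases hi : i ∈ B <;> simp [cutoff, hi, exceed_zero]

theorem iInter_exceed_compl_cutoff (B : Finset (Fin d)) (u : Fin d → ℝ≥0) :
    (⋂ i, (exceed (cutoff B u i) i)ᶜ) = ⋂ i ∈ B, (exceed (u i) i)ᶜ := by
  refine Set.iInter_congr fun i => ?_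
  by_cases hi : i ∈ B <;> simp [cutoff, hi, exceed_zero]

theorem cutoff_smul (B : Finset (Fin d)) (s : ℝ≥0) (u : Fin d → ℝ≥0) :
    cutoff B (s • u) = s • cutoff B u := by
  ext i
  by_cases hi : i ∈ B <;> simp [cutoff, hi]

end Basic

/-! ### Laws and exponent measures in terms of the tail dependence function -/

section Descriptors

variable {d : ℕ} {G Λ : Measure (Fin d → ℝ)} {ℓ : (Fin d → ℝ≥0) → ℝ≥0}

theorem IsStableTailDependenceFunction.measureReal_lower
    (hℓ : IsStableTailDependenceFunction G ℓ) (u : Fin d → ℝ≥0) :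
    G.real (⋂ i, (exceed (u i) i)ᶜ) = Real.exp (-(ℓ u : ℝ)) := by
  have h := hℓ.distFun_eq (fun i => (u i : ℝ≥0∞)⁻¹) (inv_coe_pos u)
  simp only [inv_inv, ENNReal.toNNReal_coe, distFun, ofReal_le_inv_iff] at h
  rw [← h]
  congr 1
  ext y
  simp [exceed]

theorem IsStableTailDependenceFunction.measureReal_biInter_compl
    (hℓ : IsStableTailDependenceFunction G ℓ) (B : Finset (Fin d)) (u : Fin d → ℝ≥0) :
    G.real (⋂ i ∈ B, (exceed (u i) i)ᶜ) = Real.exp (-(ℓ (cutoff B u) : ℝ)) := by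
  rw [← iInter_exceed_compl_cutoff, hℓ.measureReal_lower]

/-- Both descriptors give `-log G`, and the exponential is injective. -/
theorem IsExponentMeasure.measureReal_iUnion (hΛ : IsExponentMeasure G Λ)
    (hℓ : IsStableTailDependenceFunction G ℓ) (u : Fin d → ℝ≥0) :
    Λ.real (⋃ i, exceed (u i) i) = ℓ u := by
  have h := hℓ.distFun_eq (fun i => (u i : ℝ≥0∞)⁻¹) (inv_coe_pos u)
  rw [hΛ.distFun_eq (fun i => (u i : ℝ≥0∞)⁻¹) (inv_coe_pos u), Real.exp_eq_exp, neg_inj] at h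
  simp only [inv_inv, ENNReal.toNNReal_coe] at h
  rw [← h]
  congr 1
  ext y
  simp only [Set.mem_iUnion, exceed, Set.mem_ofPred_eq]
  exact exists_congr fun i => by rw [← not_le, ← not_le, ofReal_le_inv_iff]

theorem IsExponentMeasure.measureReal_biUnion (hΛ : IsExponentMeasure G Λ)
    (hℓ : IsStableTailDependenceFunction G ℓ) (B : Finset (Fin d)) (u : Fin d → ℝ≥0) :
    Λ.real (⋃ i ∈ B, exceed (u i) i) = ℓ (cutoff B u) := by
  rw [← iUnion_exceed_cutoff, hΛ.measureReal_iUnion hℓ]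

theorem IsExponentMeasure.measure_exceed_ne_top (hΛ : IsExponentMeasure G Λ) (c : ℝ≥0)
    (i : Fin d) : Λ (exceed c i) ≠ ∞ := by
  rcases eq_or_ne c 0 with rfl | hc
  · simp [exceed_zero]
  · have hc' : (0 : ℝ) < c := by positivity
    have h1 : exceed c i = ((c : ℝ)⁻¹) • {y : Fin d → ℝ | 1 < y i} := by
      ext y
      rw [Set.mem_inv_smul_set_iff₀ hc'.ne']
      simp [exceed]
    rw [h1, hΛ.homogeneous _ (inv_pos.2 hc') _ (measurableSet_lt measurable_const
      (measurable_pi_apply i)), hΛ.normalised]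
    simp

theorem IsExponentMeasure.measure_iUnion_ne_top (hΛ : IsExponentMeasure G Λ)
    (u : Fin d → ℝ≥0) : Λ (⋃ i, exceed (u i) i) ≠ ∞ := by
  refine ((measure_iUnion_fintype_le Λ fun i => exceed (u i) i).trans_lt ?_).ne
  exact ENNReal.sum_lt_top.2 fun i _ => (hΛ.measure_exceed_ne_top _ _).lt_top

theorem IsExponentMeasure.measure_biInter_ne_top (hΛ : IsExponentMeasure G Λ)
    {A : Finset (Fin d)} (hA : A.Nonempty) (u : Fin d → ℝ≥0) :
    Λ (⋂ i ∈ A, exceed (u i) i) ≠ ∞ := by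
  obtain ⟨i, hi⟩ := hA
  exact measure_ne_top_of_subset (Set.biInter_subset_of_mem hi) (hΛ.measure_exceed_ne_top (u i) i)

theorem IsExponentMeasure.measureReal_biInter (hΛ : IsExponentMeasure G Λ)
    (hℓ : IsStableTailDependenceFunction G ℓ) {A : Finset (Fin d)} (hA : A.Nonempty)
    (u : Fin d → ℝ≥0) :
    Λ.real (⋂ i ∈ A, exceed (u i) i) =
      ∑ B ∈ A.powerset, (-1 : ℝ) ^ (B.card + 1) * ℓ (cutoff B u) := by
  rw [measureReal_biInter_eq_sum_biUnion Λ hA (fun i => measurableSet_exceed _ _)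
    fun i _ => hΛ.measure_exceed_ne_top _ _]
  exact Finset.sum_congr rfl fun B _ => by rw [hΛ.measureReal_biUnion hℓ]

theorem IsExponentMeasure.tailDependence_cutoff (hΛ : IsExponentMeasure G Λ)
    (hℓ : IsStableTailDependenceFunction G ℓ) (B : Finset (Fin d)) (u : Fin d → ℝ≥0) :
    (ℓ (cutoff B u) : ℝ) = ∑ C ∈ B.powerset with C.Nonempty,
      (-1 : ℝ) ^ (C.card + 1) * Λ.real (⋂ i ∈ C, exceed (u i) i) := by
  rw [← hΛ.measureReal_biUnion hℓ, measureReal_biUnion_eq_sum_powerset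
    (fun i _ => measurableSet_exceed _ _) fun i _ => hΛ.measure_exceed_ne_top _ _]

theorem IsStableTailDependenceFunction.measureReal_biInter [IsProbabilityMeasure G]
    (hℓ : IsStableTailDependenceFunction G ℓ) (A : Finset (Fin d)) (u : Fin d → ℝ≥0) :
    G.real (⋂ i ∈ A, exceed (u i) i) =
      ∑ B ∈ A.powerset, (-1 : ℝ) ^ B.card * Real.exp (-(ℓ (cutoff B u) : ℝ)) := by
  have h := MaxStable.measureReal_biInter_compl G A
    (fun i => (measurableSet_exceed (u i) i).compl)
  simp only [compl_compl] at h
  rw [h]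
  exact Finset.sum_congr rfl fun B _ => by rw [hℓ.measureReal_biInter_compl]

/-- The geometric interpolation `G ^ (1 - t) * G' ^ t` of two simple max-stable distribution
functions is the distribution function of `max ((1 - t) X) (t X')` with independent `X ∼ G`,
`X' ∼ G'`; in particular its rectangle differences are nonnegative. -/
theorem sum_neg_one_pow_mul_exp_interpolation_nonneg {G' : Measure (Fin d → ℝ)}
    {ℓ' : (Fin d → ℝ≥0) → ℝ≥0} [IsProbabilityMeasure G] [IsProbabilityMeasure G']
    (hℓ : IsStableTailDependenceFunction G ℓ) (hℓ' : IsStableTailDependenceFunction G' ℓ')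
    (C A : Finset (Fin d)) (u : Fin d → ℝ≥0) {s t : ℝ} (hs : 0 ≤ s) (ht : 0 ≤ t) :
    0 ≤ ∑ D ∈ A.powerset, (-1 : ℝ) ^ D.card *
      Real.exp (-(s * ℓ (cutoff (C ∪ D) u) + t * ℓ' (cutoff (C ∪ D) u))) := by
  lift s to ℝ≥0 using hs
  lift t to ℝ≥0 using ht
  -- `E i` is the event that coordinate `i` of `max (s X) (t X')` is at most `1 / u i`. The sum is
  -- the probability that `E i` holds for `i ∈ C` and fails for `i ∈ A`.
  set E : Fin d → Set ((Fin d → ℝ) × (Fin d → ℝ)) := fun i =>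
    (exceed ((s • u) i) i)ᶜ ×ˢ (exceed ((t • u) i) i)ᶜ with hE
  have hEm : ∀ i, MeasurableSet (E i) := fun i =>
    (measurableSet_exceed _ _).compl.prod (measurableSet_exceed _ _).compl
  have h := measureReal_inter_biInter_compl (G.prod G') (S := ⋂ i ∈ C, E i)
    (measure_ne_top _ _) A hEm
  have h1 : ∀ D : Finset (Fin d), (G.prod G').real ((⋂ i ∈ D, E i) ∩ ⋂ i ∈ C, E i) =
      Real.exp (-(s * ℓ (cutoff (C ∪ D) u) + t * ℓ' (cutoff (C ∪ D) u))) := by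
    intro D
    have h2 : (⋂ i ∈ D, E i) ∩ (⋂ i ∈ C, E i) =
        (⋂ i ∈ C ∪ D, (exceed ((s • u) i) i)ᶜ) ×ˢ (⋂ i ∈ C ∪ D, (exceed ((t • u) i) i)ᶜ) := by
      ext y
      simp only [hE, Set.mem_inter_iff, Set.mem_iInter, Set.mem_prod, Finset.mem_union]
      grind
    rw [h2, measureReal_prod_prod, hℓ.measureReal_biInter_compl, hℓ'.measureReal_biInter_compl,
      cutoff_smul, cutoff_smul, hℓ.homogeneous, hℓ'.homogeneous, ← Real.exp_add]
    push_cast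
    ring_nf
  rw [Finset.sum_congr rfl fun D _ => by rw [← h1 D], ← h]
  exact measureReal_nonneg

/-- This is the core of (b): differentiation at the origin gives one direction, geometric
interpolation the other. -/
theorem IsExponentMeasure.measureReal_biInter_le_iff {G' Λ' : Measure (Fin d → ℝ)}
    {ℓ' : (Fin d → ℝ≥0) → ℝ≥0} [IsProbabilityMeasure G] [IsProbabilityMeasure G']
    (hΛ : IsExponentMeasure G Λ) (hΛ' : IsExponentMeasure G' Λ')
    (hℓ : IsStableTailDependenceFunction G ℓ) (hℓ' : IsStableTailDependenceFunction G' ℓ') :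
    (∀ A : Finset (Fin d), A.Nonempty → ∀ u : Fin d → ℝ≥0, (∀ i, 0 < u i) →
      G.real (⋂ i ∈ A, exceed (u i) i) ≤ G'.real (⋂ i ∈ A, exceed (u i) i)) ↔
    (∀ A : Finset (Fin d), A.Nonempty → ∀ u : Fin d → ℝ≥0, (∀ i, 0 < u i) →
      Λ.real (⋂ i ∈ A, exceed (u i) i) ≤ Λ'.real (⋂ i ∈ A, exceed (u i) i)) := by
  constructor
  · intro h A hA u hu
    rw [hΛ.measureReal_biInter hℓ hA, hΛ'.measureReal_biInter hℓ' hA]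
    refine sum_neg_one_pow_mul_le_of_exp_neg hA fun s hs => ?_
    lift s to ℝ≥0 using hs.le
    have hs' : 0 < s := by exact_mod_cast hs
    -- By homogeneity, scaling `u` by `s` multiplies every exponent by `s`, which supplies the whole
    -- family to be differentiated.
    have h1 := h A hA (s • u) fun i => mul_pos hs' (hu i)
    rw [hℓ.measureReal_biInter, hℓ'.measureReal_biInter] at h1
    simpa [cutoff_smul, hℓ.homogeneous, hℓ'.homogeneous] using h1
  · intro h A hA u hu
    rw [hℓ.measureReal_biInter, hℓ'.measureReal_biInter]
    refine sum_neg_one_pow_mul_exp_neg_mono A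
      (m := fun C => Λ.real (⋂ i ∈ C, exceed (u i) i))
      (m' := fun C => Λ'.real (⋂ i ∈ C, exceed (u i) i))
      (V := fun B => ℓ (cutoff B u)) (V' := fun B => ℓ' (cutoff B u))
      (fun B _ => hΛ.tailDependence_cutoff hℓ B u) (fun B _ => hΛ'.tailDependence_cutoff hℓ' B u)
      (fun C _ hC => h C hC u hu) fun t ht0 ht1 C _ => ?_
    exact sum_neg_one_pow_mul_exp_interpolation_nonneg hℓ hℓ' C (A \ C) u
      (sub_nonneg.2 ht1.le) ht0.le

end Descriptors

/-! ### Generators and the max-zonoid -/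

section Generator

variable {d : ℕ} [NeZero d] {G : Measure (Fin d → ℝ)} {ℓ : (Fin d → ℝ≥0) → ℝ≥0}
  {Ω : Type*} [MeasurableSpace Ω] {P : Measure Ω} {Z : Ω → Fin d → ℝ}

theorem IsGenerator.integral_sup' (hZ : IsGenerator G P Z)
    (hℓ : IsStableTailDependenceFunction G ℓ) (u : Fin d → ℝ≥0) :
    ∫ ω, Finset.univ.sup' Finset.univ_nonempty (fun i => (u i : ℝ) * Z ω i) ∂P = ℓ u := by
  have h := hℓ.distFun_eq (fun i => (u i : ℝ≥0∞)⁻¹) (inv_coe_pos u)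
  rw [hZ.distFun_eq (fun i => (u i : ℝ≥0∞)⁻¹) (inv_coe_pos u), Real.exp_eq_exp, neg_inj] at h
  simpa [mul_comm] using h

theorem IsGenerator.integrable_sup' (hZ : IsGenerator G P Z) (u : Fin d → ℝ≥0) :
    Integrable (fun ω => Finset.univ.sup' Finset.univ_nonempty
      (fun i => (u i : ℝ) * Z ω i)) P := by
  have h : Integrable (Finset.univ.sup' Finset.univ_nonempty
      (fun (i : Fin d) (ω : Ω) => (u i : ℝ) * Z ω i)) P :=
    Finset.sup'_induction (p := fun f : Ω → ℝ => Integrable f P) Finset.univ_nonempty _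
      (fun f hf g hg => hf.sup hg) fun i _ => (hZ.integrable i).const_mul _
  convert h using 1
  ext ω
  simp [Finset.sup'_apply]

theorem IsGenerator.integral_inf' (hZ : IsGenerator G P Z)
    (hℓ : IsStableTailDependenceFunction G ℓ) {A : Finset (Fin d)} (hA : A.Nonempty)
    (u : Fin d → ℝ≥0) :
    ∫ ω, A.inf' hA (fun i => (u i : ℝ) * Z ω i) ∂P =
      ∑ B ∈ A.powerset, (-1 : ℝ) ^ (B.card + 1) * ℓ (cutoff B u) := by
  have h1 : (fun ω => A.inf' hA (fun i => (u i : ℝ) * Z ω i)) =ᵐ[P] fun ω =>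
      ∑ B ∈ A.powerset, (-1 : ℝ) ^ (B.card + 1) *
        Finset.univ.sup' Finset.univ_nonempty (fun i => (cutoff B u i : ℝ) * Z ω i) := by
    filter_upwards [hZ.nonneg] with ω hω
    refine (inf'_eq_sum_sup' hA (t := fun i => (u i : ℝ) * Z ω i)
      fun i => mul_nonneg (u i).2 (hω i)).trans ?_
    refine Finset.sum_congr rfl fun B _ => ?_
    congr 2
    ext i
    by_cases hi : i ∈ B <;> simp [cutoff, hi]
  rw [integral_congr_ae h1, integral_finsetSum _ fun B _ => (hZ.integrable_sup' _).const_mul _]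
  exact Finset.sum_congr rfl fun B _ => by rw [integral_const_mul, hZ.integral_sup' hℓ]

theorem IsGenerator.mono (hZ : IsGenerator G P Z) (hℓ : IsStableTailDependenceFunction G ℓ) :
    Monotone ℓ := by
  intro u v huv
  rw [← NNReal.coe_le_coe, ← hZ.integral_sup' hℓ, ← hZ.integral_sup' hℓ]
  refine integral_mono_ae (hZ.integrable_sup' u) (hZ.integrable_sup' v) ?_
  filter_upwards [hZ.nonneg] with ω hω
  exact Finset.sup'_mono_fun fun i _ => mul_le_mul_of_nonneg_right (huv i) (hω i)

/-- The maximum of a sum is at most the sum of the maxima. Letting `c` tend to `0` transfers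
inequalities from positive points to the boundary. -/
theorem IsGenerator.tailDependence_add_const_le (hZ : IsGenerator G P Z)
    (hℓ : IsStableTailDependenceFunction G ℓ) (u : Fin d → ℝ≥0) (c : ℝ≥0) :
    ℓ (u + fun _ => c) ≤ ℓ u + c * ℓ 1 := by
  have h2 : c * ℓ 1 = ℓ (fun _ => c) := by
    rw [← hℓ.homogeneous]; congr 1; ext i; simp
  rw [h2, ← NNReal.coe_le_coe, NNReal.coe_add, ← hZ.integral_sup' hℓ, ← hZ.integral_sup' hℓ,
    ← hZ.integral_sup' hℓ, ← integral_add (hZ.integrable_sup' _) (hZ.integrable_sup' _)]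
  refine integral_mono (hZ.integrable_sup' _)
    ((hZ.integrable_sup' _).add (hZ.integrable_sup' _)) fun ω => ?_
  refine Finset.sup'_le _ _ fun i hi => ?_
  simp only [Pi.add_apply, NNReal.coe_add, add_mul]
  exact add_le_add (Finset.le_sup' (fun i => (u i : ℝ) * Z ω i) hi)
    (Finset.le_sup' (fun i => (c : ℝ) * Z ω i) hi)

/-- The support function of the max-zonoid is attained. -/
theorem IsGenerator.exists_mem_maxZonoid (hZ : IsGenerator G P Z)
    (hℓ : IsStableTailDependenceFunction G ℓ) (u : Fin d → ℝ≥0) :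
    ∃ k ∈ maxZonoid ℓ, ∑ i, k i * (u i : ℝ) = ℓ u := by
  classical
  have hZm : ∀ i, Measurable fun ω => Z ω i := fun i => (measurable_pi_apply i).comp hZ.measurable
  -- `M i` is the event that `i` is the smallest index attaining the maximum. Breaking ties this way
  -- partitions `Ω`, and the maximizer is `k i = E[Z i; M i]`.
  let M : Fin d → Set Ω := fun i =>
    {ω | (∀ j, (u j : ℝ) * Z ω j ≤ u i * Z ω i) ∧ ∀ j < i, (u j : ℝ) * Z ω j < u i * Z ω i}
  have hM : ∀ i, MeasurableSet (M i) := by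
    intro i
    have h1 : M i = (⋂ j, {ω | (u j : ℝ) * Z ω j ≤ u i * Z ω i}) ∩
        ⋂ j, ⋂ (_ : j < i), {ω | (u j : ℝ) * Z ω j < u i * Z ω i} := by
      ext ω; simp [M]
    rw [h1]
    exact (MeasurableSet.iInter fun j => measurableSet_le ((hZm j).const_mul _)
      ((hZm i).const_mul _)).inter (MeasurableSet.iInter fun j => MeasurableSet.iInter fun _ =>
        measurableSet_lt ((hZm j).const_mul _) ((hZm i).const_mul _))
  have hex : ∀ ω, ∃ i, ω ∈ M i ∧ ∀ j, ω ∈ M j → j = i := by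
    intro ω
    let S : Finset (Fin d) := Finset.univ.filter fun i => ∀ j, (u j : ℝ) * Z ω j ≤ u i * Z ω i
    have hS : S.Nonempty := by
      obtain ⟨i, -, hi⟩ := Finset.exists_max_image Finset.univ (fun i => (u i : ℝ) * Z ω i)
        Finset.univ_nonempty
      exact ⟨i, by simpa [S] using fun j => hi j (Finset.mem_univ j)⟩
    have hmin := S.min'_mem hS
    have hS1 : ∀ j, (u j : ℝ) * Z ω j ≤ u (S.min' hS) * Z ω (S.min' hS) := by
      simpa only [S, Finset.mem_filter, Finset.mem_univ, true_and] using hmin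
    have hmem : ω ∈ M (S.min' hS) := by
      refine ⟨hS1, fun j hj => lt_of_not_ge fun hle => ?_⟩
      have : j ∈ S := by simpa [S] using fun k => (hS1 k).trans hle
      exact absurd (S.min'_le j this) (not_le.2 hj)
    refine ⟨_, hmem, fun j hj => ?_⟩
    rcases lt_trichotomy j (S.min' hS) with h | h | h
    · exact absurd (hj.1 _) (not_le.2 (hmem.2 j h))
    · exact h
    · exact absurd (hmem.1 _) (not_le.2 (hj.2 _ h))
  have hI : ∀ i, Integrable ((M i).indicator fun ω => Z ω i) P :=
    fun i => (hZ.integrable i).indicator (hM i)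
  have hsum : ∀ v : Fin d → ℝ≥0, ∑ i, (∫ ω, (M i).indicator (fun ω => Z ω i) ω ∂P) * (v i : ℝ) =
      ∫ ω, ∑ i, (v i : ℝ) * (M i).indicator (fun ω => Z ω i) ω ∂P := by
    intro v
    rw [integral_finsetSum _ fun i _ => (hI i).const_mul _]
    exact Finset.sum_congr rfl fun i _ => by rw [integral_const_mul, mul_comm]
  have hpt : ∀ (v : Fin d → ℝ≥0) (ω : Ω) (i : Fin d), ω ∈ M i → (∀ j, ω ∈ M j → j = i) →
      ∑ i, (v i : ℝ) * (M i).indicator (fun ω => Z ω i) ω = v i * Z ω i := by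
    intro v ω i hi huniq
    rw [Finset.sum_eq_single i]
    · rw [Set.indicator_of_mem hi]
    · intro j _ hj
      rw [Set.indicator_of_notMem fun h => hj (huniq j h), mul_zero]
    · simp
  refine ⟨fun i => ∫ ω, (M i).indicator (fun ω => Z ω i) ω ∂P, ⟨fun i => ?_, fun v => ?_⟩, ?_⟩
  · refine integral_nonneg_of_ae ?_
    filter_upwards [hZ.nonneg] with ω hω
    exact Set.indicator_apply_nonneg fun _ => hω i
  · rw [hsum, ← hZ.integral_sup' hℓ]
    refine integral_mono (integrable_finsetSum _ fun i _ => (hI i).const_mul _)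
      (hZ.integrable_sup' v) fun ω => ?_
    obtain ⟨i, hi, huniq⟩ := hex ω
    simp only [hpt v ω i hi huniq]
    exact Finset.le_sup' (fun i => (v i : ℝ) * Z ω i) (Finset.mem_univ i)
  · rw [hsum, ← hZ.integral_sup' hℓ]
    congr 1
    ext ω
    obtain ⟨i, hi, huniq⟩ := hex ω
    rw [hpt u ω i hi huniq]
    exact le_antisymm (Finset.le_sup' (fun i => (u i : ℝ) * Z ω i) (Finset.mem_univ i))
      (Finset.sup'_le _ _ fun j _ => hi.1 j)

end Generator

/-! ### Reducing orthant orders to intersections of half spaces -/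

section Orthants

variable {d : ℕ} {G Λ : Measure (Fin d → ℝ)} {ℓ : (Fin d → ℝ≥0) → ℝ≥0}

/-- The indices of the positive coordinates of `a`. -/
noncomputable def posIndices (a : Fin d → ℝ) : Finset (Fin d) := Finset.univ.filter fun i => 0 < a i

/-- The reciprocals of the positive coordinates of `a`, and `1` elsewhere. -/
noncomputable def posInv (a : Fin d → ℝ) : Fin d → ℝ≥0 :=
  fun i => if 0 < a i then (a i)⁻¹.toNNReal else 1

theorem mem_posIndices {a : Fin d → ℝ} {i : Fin d} : i ∈ posIndices a ↔ 0 < a i := by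
  simp [posIndices]

theorem posInv_pos (a : Fin d → ℝ) (i : Fin d) : 0 < posInv a i := by
  unfold posInv
  split_ifs with h
  · simpa using h
  · exact one_pos

theorem mem_exceed_posInv {a : Fin d → ℝ} {i : Fin d} (h : 0 < a i) (y : Fin d → ℝ) :
    y ∈ exceed (posInv a i) i ↔ a i < y i := by
  simp only [exceed, posInv, h, if_true, Set.mem_ofPred_eq,
    Real.coe_toNNReal _ (inv_pos.2 h).le]
  rw [inv_mul_eq_div, one_lt_div h]

/-- The point with coordinates `1 / u_i` for `i ∈ A` and `-1` elsewhere. -/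
noncomputable def orthantVertex (A : Finset (Fin d)) (u : Fin d → ℝ≥0) : Fin d → ℝ :=
  fun i => if i ∈ A then (u i : ℝ)⁻¹ else -1

theorem posIndices_orthantVertex {A : Finset (Fin d)} {u : Fin d → ℝ≥0} (hu : ∀ i, 0 < u i) :
    posIndices (orthantVertex A u) = A := by
  ext i
  rw [mem_posIndices, orthantVertex]
  have := hu i
  split_ifs with h
  · simpa [h] using this
  · simp only [h, iff_false]; norm_num

theorem posInv_orthantVertex {A : Finset (Fin d)} {u : Fin d → ℝ≥0} (hu : ∀ i, 0 < u i)
    {i : Fin d} (hi : i ∈ A) : posInv (orthantVertex A u) i = u i := by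
  have h : 0 < orthantVertex A u i := by
    rwa [← mem_posIndices, posIndices_orthantVertex hu]
  rw [posInv, if_pos h, orthantVertex, if_pos hi, inv_inv, Real.toNNReal_coe]

theorem biInter_exceed_orthantVertex {A : Finset (Fin d)} {u : Fin d → ℝ≥0}
    (hu : ∀ i, 0 < u i) :
    (⋂ i ∈ posIndices (orthantVertex A u), exceed (posInv (orthantVertex A u) i) i) =
      ⋂ i ∈ A, exceed (u i) i := by
  rw [posIndices_orthantVertex hu]
  exact Set.iInter₂_congr fun i hi => by rw [posInv_orthantVertex hu hi]

/-- Constraints at nonpositive thresholds hold almost everywhere, so only the positive coordinates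
of `a` matter. -/
theorem measure_upperOrthant_of_ae {μ : Measure (Fin d → ℝ)} {a : Fin d → ℝ}
    (h : ∀ᵐ y ∂μ, ∀ i, a i ≤ 0 → a i < y i) :
    μ (upperOrthant a) = μ (⋂ i ∈ posIndices a, exceed (posInv a i) i) := by
  refine measure_congr ?_
  filter_upwards [h] with y hy
  refine propext ?_
  change y ∈ upperOrthant a ↔ y ∈ ⋂ i ∈ posIndices a, exceed (posInv a i) i
  simp only [upperOrthant, Set.mem_ofPred_eq, Set.mem_iInter, mem_posIndices]
  refine ⟨fun h1 i hi => (mem_exceed_posInv hi y).2 (h1 i), fun h1 i => ?_⟩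
  rcases lt_or_ge 0 (a i) with hi | hi
  · exact (mem_exceed_posInv hi y).1 (h1 i hi)
  · exact hy i hi

theorem IsSimpleMaxStable.ae_pos (hG : IsSimpleMaxStable G) : ∀ᵐ y ∂G, ∀ i, 0 < y i := by
  have := hG.isProbabilityMeasure
  refine ae_all_iff.2 fun i => ?_
  rw [ae_iff]
  -- The Fréchet margin at `1 / x` bounds the mass of `y i ≤ 0` by `exp (-x)`, which tends to zero.
  have h1 : ∀ x : ℝ, 0 < x → G.real {y | ¬ 0 < y i} ≤ Real.exp (-x) := by
    intro x hx
    have h2 := hG.frechet_margins i (1 / x) (by positivity)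
    rw [one_div_one_div] at h2
    rw [← h2]
    refine measureReal_mono fun y hy => ?_
    simp only [not_lt, Set.mem_ofPred_eq] at hy ⊢
    exact hy.trans (by positivity)
  have h3 : G.real {y | ¬ 0 < y i} ≤ 0 :=
    ge_of_tendsto (Real.tendsto_exp_neg_atTop_nhds_zero)
      ((Filter.eventually_gt_atTop 0).mono h1)
  exact (measureReal_eq_zero_iff).1 (le_antisymm h3 measureReal_nonneg)

theorem IsSimpleMaxStable.measure_upperOrthant (hG : IsSimpleMaxStable G) (a : Fin d → ℝ) :
    G (upperOrthant a) = G (⋂ i ∈ posIndices a, exceed (posInv a i) i) :=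
  measure_upperOrthant_of_ae (hG.ae_pos.mono fun _ hy i hi => hi.trans_lt (hy i))

/-- Zero thresholds are excluded because `Λ` may charge the faces `y i = 0`, where `0 < y i` is a
genuine constraint. -/
theorem IsExponentMeasure.measure_upperOrthant (hΛ : IsExponentMeasure G Λ) {a : Fin d → ℝ}
    (ha : ∀ i, a i ≠ 0) :
    Λ (upperOrthant a) = Λ (⋂ i ∈ posIndices a, exceed (posInv a i) i) := by
  have h : ∀ᵐ y ∂Λ, (∀ i, 0 ≤ y i) ∧ y ≠ 0 := hΛ.concentrated
  exact measure_upperOrthant_of_ae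
    (h.mono fun y hy i hi => (lt_of_le_of_ne hi (ha i)).trans_le (hy.1 i))

theorem boundedAwayFromOrigin_upperOrthant_iff (a : Fin d → ℝ) :
    BoundedAwayFromOrigin (upperOrthant a) ↔ (posIndices a).Nonempty := by
  constructor
  · rintro ⟨ε, hε, h⟩
    by_contra hne
    have h1 : ∀ i, a i ≤ 0 := fun i => not_lt.1 fun hi => hne ⟨i, mem_posIndices.2 hi⟩
    exact Set.notMem_empty (fun _ : Fin d => ε)
      (h ▸ ⟨fun i => (h1 i).trans_lt hε, fun i => le_rfl⟩)
  · rintro ⟨i, hi⟩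
    refine ⟨a i, mem_posIndices.1 hi, Set.eq_empty_of_forall_notMem fun y hy => ?_⟩
    exact absurd (hy.1 i) (not_lt.2 (hy.2 i))

theorem boundedAwayFromOrigin_lowerOrthant_compl_iff (a : Fin d → ℝ) :
    BoundedAwayFromOrigin (lowerOrthant a)ᶜ ↔ ∀ i, 0 < a i := by
  constructor
  · rintro ⟨ε, hε, h⟩ i
    by_contra hi
    have h1 : (fun _ : Fin d => ε) ∈ (lowerOrthant a)ᶜ := fun h2 =>
      hi (hε.trans_le (h2 i))
    exact Set.notMem_empty (fun _ : Fin d => ε) (h ▸ ⟨h1, fun i => le_rfl⟩)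
  · intro ha
    obtain ⟨ε, hε, hεa⟩ : ∃ ε : ℝ, 0 < ε ∧ ∀ i, ε ≤ a i := by
      rcases isEmpty_or_nonempty (Fin d) with hd | hd
      · exact ⟨1, one_pos, fun i => hd.elim i⟩
      · refine ⟨Finset.univ.inf' Finset.univ_nonempty a, ?_,
          fun i => Finset.inf'_le _ (Finset.mem_univ i)⟩
        exact (Finset.lt_inf'_iff _).2 fun i _ => ha i
    exact ⟨ε, hε, Set.eq_empty_of_forall_notMem fun y hy =>
      hy.1 fun i => (hy.2 i).trans (hεa i)⟩

/-- Zero thresholds are approached from above by `1 / (n + 1)`; continuity from below along this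
increasing union then covers orthants with vertices on the coordinate hyperplanes. -/
theorem upperOrthant_eq_iUnion (a : Fin d → ℝ) :
    upperOrthant a =
      ⋃ n : ℕ, upperOrthant (fun i => if a i = 0 then ((n : ℝ) + 1)⁻¹ else a i) := by
  ext y
  simp only [upperOrthant, Set.mem_iUnion, Set.mem_ofPred_eq]
  constructor
  · intro hy
    have h1 : ∀ᶠ n : ℕ in Filter.atTop, ∀ i,
        (if a i = 0 then ((n : ℝ) + 1)⁻¹ else a i) < y i := by
      refine Filter.eventually_all.2 fun i => ?_
      split_ifs with h
      · have h2 := hy i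
        rw [h] at h2
        have h3 := tendsto_one_div_add_atTop_nhds_zero_nat (𝕜 := ℝ)
        simpa using h3.eventually (gt_mem_nhds h2)
      · exact Filter.Eventually.of_forall fun _ => hy i
    exact h1.exists
  · rintro ⟨n, hn⟩ i
    have h1 := hn i
    split_ifs at h1 with h
    · rw [h]; exact lt_trans (by positivity) h1
    · exact h1

theorem monotone_upperOrthant_approx (a : Fin d → ℝ) :
    Monotone fun n : ℕ => upperOrthant (fun i => if a i = 0 then ((n : ℝ) + 1)⁻¹ else a i) := by
  intro n m hnm y hy i
  refine lt_of_le_of_lt ?_ (hy i)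
  have : (n : ℝ) ≤ m := by exact_mod_cast hnm
  dsimp only
  split_ifs
  · gcongr
  · exact le_rfl

theorem uole_iff {G' : Measure (Fin d → ℝ)} (hG : IsSimpleMaxStable G)
    (hG' : IsSimpleMaxStable G') :
    UOLE G G' ↔ ∀ A : Finset (Fin d), A.Nonempty → ∀ u : Fin d → ℝ≥0, (∀ i, 0 < u i) →
      G.real (⋂ i ∈ A, exceed (u i) i) ≤ G'.real (⋂ i ∈ A, exceed (u i) i) := by
  have := hG.isProbabilityMeasure
  have := hG'.isProbabilityMeasure
  constructor
  · intro h A _ u hu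
    have h1 := h (orthantVertex A u)
    rw [hG.measure_upperOrthant, hG'.measure_upperOrthant, biInter_exceed_orthantVertex hu] at h1
    exact ENNReal.toReal_mono (measure_ne_top _ _) h1
  · intro h a
    rw [hG.measure_upperOrthant, hG'.measure_upperOrthant]
    rcases (posIndices a).eq_empty_or_nonempty with h0 | h0
    · simp [h0]
    · exact (ENNReal.toReal_le_toReal (measure_ne_top _ _) (measure_ne_top _ _)).1
        (h _ h0 _ (posInv_pos a))

theorem exponentUOLE_iff {G' Λ' : Measure (Fin d → ℝ)} (hΛ : IsExponentMeasure G Λ)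
    (hΛ' : IsExponentMeasure G' Λ') :
    ExponentUOLE Λ Λ' ↔ ∀ A : Finset (Fin d), A.Nonempty → ∀ u : Fin d → ℝ≥0, (∀ i, 0 < u i) →
      Λ.real (⋂ i ∈ A, exceed (u i) i) ≤ Λ'.real (⋂ i ∈ A, exceed (u i) i) := by
  constructor
  · intro h A hA u hu
    have h0 : ∀ i, orthantVertex A u i ≠ 0 := fun i => by
      unfold orthantVertex
      split_ifs
      · exact inv_ne_zero (by exact_mod_cast (hu i).ne')
      · norm_num
    have h1 := h (orthantVertex A u) ((boundedAwayFromOrigin_upperOrthant_iff _).2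
      (by rwa [posIndices_orthantVertex hu]))
    rw [hΛ.measure_upperOrthant h0, hΛ'.measure_upperOrthant h0,
      biInter_exceed_orthantVertex hu] at h1
    exact ENNReal.toReal_mono (hΛ'.measure_biInter_ne_top hA u) h1
  · intro h a ha
    rw [boundedAwayFromOrigin_upperOrthant_iff] at ha
    have hle : ∀ b : Fin d → ℝ, (∀ i, b i ≠ 0) → (posIndices b).Nonempty →
        Λ (upperOrthant b) ≤ Λ' (upperOrthant b) := by
      intro b hb hne
      rw [hΛ.measure_upperOrthant hb, hΛ'.measure_upperOrthant hb]
      exact (ENNReal.toReal_le_toReal (hΛ.measure_biInter_ne_top hne _)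
        (hΛ'.measure_biInter_ne_top hne _)).1 (h _ hne _ (posInv_pos b))
    rw [upperOrthant_eq_iUnion a, (monotone_upperOrthant_approx a).measure_iUnion,
      (monotone_upperOrthant_approx a).measure_iUnion]
    refine iSup_mono fun n => hle _ (fun i => ?_) ?_
    · split_ifs with h1
      · positivity
      · exact h1
    · obtain ⟨i, hi⟩ := ha
      rw [mem_posIndices] at hi
      exact ⟨i, mem_posIndices.2 (by simpa [hi.ne'] using hi)⟩

theorem lowerOrthant_eq_iInter {a : Fin d → ℝ} (ha : ∀ i, 0 < a i) :
    lowerOrthant a = ⋂ i, (exceed (posInv a i) i)ᶜ := by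
  ext y
  simp only [lowerOrthant, Set.mem_ofPred_eq, Set.mem_iInter, Set.mem_compl_iff]
  exact forall_congr' fun i => by rw [mem_exceed_posInv (ha i), not_lt]

theorem inv_pos_of_pos {u : Fin d → ℝ≥0} (hu : ∀ i, 0 < u i) (i : Fin d) : 0 < (u i : ℝ)⁻¹ :=
  inv_pos.2 (by exact_mod_cast hu i)

theorem posInv_inv {u : Fin d → ℝ≥0} (hu : ∀ i, 0 < u i) :
    posInv (fun i => (u i : ℝ)⁻¹) = u := by
  ext i
  simp [posInv, hu i]

theorem lole_iff {G' : Measure (Fin d → ℝ)} {ℓ' : (Fin d → ℝ≥0) → ℝ≥0}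
    (hG : IsSimpleMaxStable G) (hG' : IsSimpleMaxStable G')
    (hℓ : IsStableTailDependenceFunction G ℓ) (hℓ' : IsStableTailDependenceFunction G' ℓ') :
    LOLE G G' ↔ ∀ u : Fin d → ℝ≥0, (∀ i, 0 < u i) → ℓ u ≤ ℓ' u := by
  have := hG.isProbabilityMeasure
  have := hG'.isProbabilityMeasure
  have key : ∀ a : Fin d → ℝ, (∀ i, 0 < a i) →
      (G' (lowerOrthant a) ≤ G (lowerOrthant a) ↔ ℓ (posInv a) ≤ ℓ' (posInv a)) := by
    intro a ha
    rw [← ENNReal.toReal_le_toReal (measure_ne_top _ _) (measure_ne_top _ _),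
      lowerOrthant_eq_iInter ha]
    change G'.real _ ≤ G.real _ ↔ _
    rw [hℓ.measureReal_lower, hℓ'.measureReal_lower, Real.exp_le_exp, neg_le_neg_iff,
      NNReal.coe_le_coe]
  constructor
  · intro h u hu
    have h1 := (key _ (inv_pos_of_pos hu)).1 (h _)
    rwa [posInv_inv hu] at h1
  · intro h a
    by_cases ha : ∀ i, 0 < a i
    · exact (key a ha).2 (h _ (posInv_pos a))
    · push Not at ha
      -- A nonpositive coordinate of `a` makes the lower orthant null, as the law lives on positive
      -- vectors.
      obtain ⟨i, hi⟩ := ha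
      refine le_of_eq_of_le ?_ zero_le
      refine measure_mono_null (fun y hy => ?_) (ae_iff.1 hG'.ae_pos)
      simp only [Set.mem_ofPred_eq, not_forall, not_lt]
      exact ⟨i, (hy i).trans hi⟩

theorem exponentLOLE_iff {G' Λ' : Measure (Fin d → ℝ)} {ℓ' : (Fin d → ℝ≥0) → ℝ≥0}
    (hΛ : IsExponentMeasure G Λ) (hΛ' : IsExponentMeasure G' Λ')
    (hℓ : IsStableTailDependenceFunction G ℓ) (hℓ' : IsStableTailDependenceFunction G' ℓ') :
    ExponentLOLE Λ Λ' ↔ ∀ u : Fin d → ℝ≥0, (∀ i, 0 < u i) → ℓ u ≤ ℓ' u := by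
  have key : ∀ a : Fin d → ℝ, (∀ i, 0 < a i) →
      (Λ (lowerOrthant a)ᶜ ≤ Λ' (lowerOrthant a)ᶜ ↔ ℓ (posInv a) ≤ ℓ' (posInv a)) := by
    intro a ha
    have h1 : (lowerOrthant a)ᶜ = ⋃ i, exceed (posInv a i) i := by
      rw [lowerOrthant_eq_iInter ha]; simp
    rw [h1, ← ENNReal.toReal_le_toReal (hΛ.measure_iUnion_ne_top _)
      (hΛ'.measure_iUnion_ne_top _)]
    change Λ.real _ ≤ Λ'.real _ ↔ _
    rw [hΛ.measureReal_iUnion hℓ, hΛ'.measureReal_iUnion hℓ', NNReal.coe_le_coe]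
  constructor
  · intro h u hu
    have h1 := (key _ (inv_pos_of_pos hu)).1
      (h _ ((boundedAwayFromOrigin_lowerOrthant_compl_iff _).2 (inv_pos_of_pos hu)))
    rwa [posInv_inv hu] at h1
  · intro h a ha
    exact (key a ((boundedAwayFromOrigin_lowerOrthant_compl_iff a).1 ha)).2 (h _ (posInv_pos a))

end Orthants

theorem forall_pos_real_iff {d : ℕ} {p : (Fin d → ℝ) → Prop} :
    (∀ a : Fin d → ℝ, (∀ i, 0 < a i) → p a) ↔
      ∀ u : Fin d → ℝ≥0, (∀ i, 0 < u i) → p fun i => (u i : ℝ) := by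
  refine ⟨fun h u hu => h _ fun i => by exact_mod_cast hu i, fun h a ha => ?_⟩
  have h1 := h (fun i => (a i).toNNReal) fun i => by simpa using ha i
  simpa [Real.coe_toNNReal _ (ha _).le] using h1

/-! ### Boundary points and support functions -/

section Comparison

variable {d : ℕ} [NeZero d] {G G' : Measure (Fin d → ℝ)} {ℓ ℓ' : (Fin d → ℝ≥0) → ℝ≥0}
  {Ω Ω' : Type*} [MeasurableSpace Ω] [MeasurableSpace Ω'] {P : Measure Ω} {P' : Measure Ω'}
  {Z : Ω → Fin d → ℝ} {Z' : Ω' → Fin d → ℝ}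

theorem tailDependence_le_iff_pos (hZ : IsGenerator G P Z) (hZ' : IsGenerator G' P' Z')
    (hℓ : IsStableTailDependenceFunction G ℓ) (hℓ' : IsStableTailDependenceFunction G' ℓ') :
    (∀ x, ℓ x ≤ ℓ' x) ↔ ∀ u : Fin d → ℝ≥0, (∀ i, 0 < u i) → ℓ u ≤ ℓ' u := by
  refine ⟨fun h u _ => h u, fun h x => ?_⟩
  have h1 : ∀ c : ℝ≥0, 0 < c → ℓ x ≤ ℓ' x + c * ℓ' 1 := fun c hc =>
    calc ℓ x ≤ ℓ (x + fun _ => c) := hZ.mono hℓ (le_add_of_nonneg_right fun _ => zero_le)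
      _ ≤ ℓ' (x + fun _ => c) := h _ fun i => by simpa using Or.inr hc
      _ ≤ _ := hZ'.tailDependence_add_const_le hℓ' x c
  have h2 : Filter.Tendsto (fun c : ℝ≥0 => ℓ' x + c * ℓ' 1) (nhdsWithin 0 (Set.Ioi 0))
      (nhds (ℓ' x + 0 * ℓ' 1)) :=
    (Continuous.tendsto (by fun_prop) _).mono_left nhdsWithin_le_nhds
  rw [zero_mul, add_zero] at h2
  exact ge_of_tendsto h2 (Filter.eventually_of_mem self_mem_nhdsWithin h1)

/-- Evaluating an inclusion at a point of `maxZonoid ℓ` where the support value `ℓ x` is attained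
recovers the inequality at `x`. -/
theorem maxZonoid_subset_iff (hZ : IsGenerator G P Z)
    (hℓ : IsStableTailDependenceFunction G ℓ) :
    maxZonoid ℓ ⊆ maxZonoid ℓ' ↔ ∀ x, ℓ x ≤ ℓ' x := by
  constructor
  · intro h x
    obtain ⟨k, hk, hkx⟩ := hZ.exists_mem_maxZonoid hℓ x
    have h1 := (h hk).2 x
    rw [hkx] at h1
    exact_mod_cast h1
  · exact fun h k hk => ⟨hk.1, fun x => (hk.2 x).trans (by exact_mod_cast h x)⟩

end Comparison

/-- The upper quadrant is the complement of a union of two half planes whose intersection is the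
lower quadrant. With equal margins, the two quadrant masses are therefore ordered the same way. -/
theorem measureReal_upperOrthant_add_margins (G : Measure (Fin 2 → ℝ)) [IsProbabilityMeasure G]
    (a : Fin 2 → ℝ) :
    G.real (upperOrthant a) + G.real {y | y 0 ≤ a 0} + G.real {y | y 1 ≤ a 1} =
      1 + G.real (lowerOrthant a) := by
  have hm : ∀ i, MeasurableSet {y : Fin 2 → ℝ | y i ≤ a i} := fun i =>
    measurableSet_le (measurable_pi_apply i) measurable_const
  have h1 : upperOrthant a = ({y | y 0 ≤ a 0} ∪ {y | y 1 ≤ a 1})ᶜ := by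
    ext y; simp [upperOrthant, Fin.forall_fin_two]
  have h2 : lowerOrthant a = {y | y 0 ≤ a 0} ∩ {y | y 1 ≤ a 1} := by
    ext y; simp [lowerOrthant, Fin.forall_fin_two]
  have h3 := measureReal_union_add_inter (μ := G) (s := {y | y 0 ≤ a 0}) (hm 1)
  rw [h1, h2, measureReal_compl ((hm 0).union (hm 1)), probReal_univ]
  linarith

theorem IsSimpleMaxStable.measureReal_margin_eq {d : ℕ} {G G' : Measure (Fin d → ℝ)}
    (hG : IsSimpleMaxStable G) (hG' : IsSimpleMaxStable G') (i : Fin d) (x : ℝ) :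
    G.real {y | y i ≤ x} = G'.real {y | y i ≤ x} := by
  rcases lt_or_ge 0 x with hx | hx
  · rw [hG.frechet_margins i x hx, hG'.frechet_margins i x hx]
  · have h0 : ∀ H : Measure (Fin d → ℝ), IsSimpleMaxStable H → H.real {y | y i ≤ x} = 0 := by
      intro H hH
      rw [Measure.real, measure_mono_null (fun y hy => ?_) (ae_iff.1 hH.ae_pos),
        ENNReal.toReal_zero]
      simp only [Set.mem_ofPred_eq, not_forall, not_lt] at hy ⊢
      exact ⟨i, hy.trans hx⟩
    rw [h0 G hG, h0 G' hG']

theorem uole_iff_lole_of_dim_two {G G' : Measure (Fin 2 → ℝ)} (hG : IsSimpleMaxStable G)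
    (hG' : IsSimpleMaxStable G') : UOLE G G' ↔ LOLE G' G := by
  have := hG.isProbabilityMeasure
  have := hG'.isProbabilityMeasure
  refine forall_congr' fun a => ?_
  rw [← ENNReal.toReal_le_toReal (measure_ne_top _ _) (measure_ne_top _ _),
    ← ENNReal.toReal_le_toReal (measure_ne_top _ _) (measure_ne_top _ _)]
  change G.real _ ≤ G'.real _ ↔ G.real _ ≤ G'.real _
  have h1 := measureReal_upperOrthant_add_margins G a
  have h2 := measureReal_upperOrthant_add_margins G' a
  rw [hG.measureReal_margin_eq hG', hG.measureReal_margin_eq hG'] at h1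
  constructor <;> intro h <;> linarith

end MaxStable

/-! ### The equivalences -/

theorem theorem4p1 {d : ℕ} [NeZero d]
    -- simple max-stable laws and their exponent measures
    (G G' Λ Λ' : Measure (Fin d → ℝ))
    (hG : IsSimpleMaxStable G) (hG' : IsSimpleMaxStable G')
    (hΛ : IsExponentMeasure G Λ) (hΛ' : IsExponentMeasure G' Λ')
    -- generators
    {Ω Ω' : Type*} [MeasurableSpace Ω] [MeasurableSpace Ω']
    (P : Measure Ω) (P' : Measure Ω') [IsProbabilityMeasure P] [IsProbabilityMeasure P']
    (Z : Ω → Fin d → ℝ) (Z' : Ω' → Fin d → ℝ)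
    (hZ : IsGenerator G P Z) (hZ' : IsGenerator G' P' Z')
    -- stable tail dependence functions
    (ℓ ℓ' : (Fin d → ℝ≥0) → ℝ≥0)
    (hℓ : IsStableTailDependenceFunction G ℓ) (hℓ' : IsStableTailDependenceFunction G' ℓ') :
    -- (a)
    List.TFAE
      [ LOLE G G',
        ExponentLOLE Λ Λ',
        ∀ a : Fin d → ℝ, (∀ i, 0 < a i) →
          ∫ ω, Finset.univ.sup' Finset.univ_nonempty (fun i => a i * Z ω i) ∂P
            ≤ ∫ ω, Finset.univ.sup' Finset.univ_nonempty (fun i => a i * Z' ω i) ∂P',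
        ∀ x, ℓ x ≤ ℓ' x,
        maxZonoid ℓ ⊆ maxZonoid ℓ' ] ∧
    -- (b)
    List.TFAE
      [ UOLE G G',
        ExponentUOLE Λ Λ',
        ∀ a : Fin d → ℝ, (∀ i, 0 < a i) → ∀ (A : Finset (Fin d)) (hA : A.Nonempty),
          ∫ ω, A.inf' hA (fun i => a i * Z ω i) ∂P
            ≤ ∫ ω, A.inf' hA (fun i => a i * Z' ω i) ∂P' ] ∧
    -- (c)
    (d = 2 → List.TFAE [ PQDLE G G', UOLE G G', LOLE G' G ]) := by
  have := hG.isProbabilityMeasure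
  have := hG'.isProbabilityMeasure
  refine ⟨?_, ?_, ?_⟩
  · tfae_have 1 ↔ 4 :=
      (lole_iff hG hG' hℓ hℓ').trans (tailDependence_le_iff_pos hZ hZ' hℓ hℓ').symm
    tfae_have 2 ↔ 4 :=
      (exponentLOLE_iff hΛ hΛ' hℓ hℓ').trans (tailDependence_le_iff_pos hZ hZ' hℓ hℓ').symm
    tfae_have 3 ↔ 4 := by
      rw [tailDependence_le_iff_pos hZ hZ' hℓ hℓ', forall_pos_real_iff]
      refine forall₂_congr fun u _ => ?_
      rw [hZ.integral_sup' hℓ, hZ'.integral_sup' hℓ', NNReal.coe_le_coe]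
    tfae_have 5 ↔ 4 := maxZonoid_subset_iff hZ hℓ
    tfae_finish
  · tfae_have 1 ↔ 2 := by
      rw [uole_iff hG hG', exponentUOLE_iff hΛ hΛ', hΛ.measureReal_biInter_le_iff hΛ' hℓ hℓ']
    tfae_have 2 ↔ 3 := by
      rw [exponentUOLE_iff hΛ hΛ', forall_pos_real_iff]
      have key : ∀ (A : Finset (Fin d)) (hA : A.Nonempty) (u : Fin d → ℝ≥0),
          Λ.real (⋂ i ∈ A, exceed (u i) i) ≤ Λ'.real (⋂ i ∈ A, exceed (u i) i) ↔
          ∫ ω, A.inf' hA (fun i => (u i : ℝ) * Z ω i) ∂P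
            ≤ ∫ ω, A.inf' hA (fun i => (u i : ℝ) * Z' ω i) ∂P' := by
        intro A hA u
        rw [hZ.integral_inf' hℓ, hZ'.integral_inf' hℓ', hΛ.measureReal_biInter hℓ hA,
          hΛ'.measureReal_biInter hℓ' hA]
      exact ⟨fun h u hu A hA => (key A hA u).1 (h A hA u hu),
        fun h A hA u hu => (key A hA u).2 (h u hu A hA)⟩
    tfae_finish
  · rintro rfl
    have h := uole_iff_lole_of_dim_two hG hG'
    tfae_have 1 ↔ 2 := ⟨fun h1 => h1.1, fun h2 => ⟨h2, h.1 h2⟩⟩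
    tfae_have 2 ↔ 3 := h
    tfae_finish
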